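/- Let $0\le m<n$ and $N$ be integers, $\Omega\subset\mathbb R^N$ a bounded, connected, open set, $\omega\subset\Omega$ a nonempty open subset, $T>0$, $Q_T=(0,T)\times\Omega$. Let $d_1,\dots,d_n>0$ with $d_k\neq d_l$ for all $k\ne l$ in $\{m+1,\dots,n\}$, let $\alpha_i,\beta_i\in\mathbb N$ with $\alpha_i\neq\beta_i$ ($1\le i\le n$), and put $$f_i(a)=(\beta_i-\alpha_i)\Big(\prod_{k=1}^n a_k^{\alpha_k}-\prod_{k=1}^n a_k^{\beta_k}\Big),\qquad a\in\mathbb R^n .$$ Let $U^*=(u_1^*,\dots,u_n^*)\in[0,\infty)^n$ satisfy $\prod_k (u_k^*)^{\alpha_k}=\prod_k (u_k^*)^{\beta_k}$. Let $P\in\mathbb R^{n\times n}$ be the block diagonal matrix with first block $I_m$ and, for $k,l\ge m+1$, $$P_{kl}=\Big((\beta_l-\alpha_l)\prod_{\substack{m+1\le r\le k\\ r\ne l}}(d_l-d_r)\Big)^{-1}\ \text{if } k\ge l,\qquad P_{kl}=0\ \text{if } k<l .$$ Let $W_T=L^2(0,T;H^1(\Omega))\cap H^1(0,T;(H^1(\Omega))')$.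 For $D\in\mathbb R^{n\times n}$, a function $Y\in (W_T\cap L^\infty(Q_T))^n$ is a (weak) solution of $\partial_tY-D\Delta Y=S(t,x,Y)$ in $Q_T$, $\partial Y/\partial\nu=0$ on $(0,T)\times\partial\Omega$, $Y(0,\cdot)=Y_0$, if $Y(0,\cdot)=Y_0$ (for the representative in $C([0,T];L^2(\Omega)^n)$) and, for all $V\in L^2(0,T;H^1(\Omega)^n)$, $$\int_0^T\langle\partial_tY,V\rangle\,dt+\int_{Q_T}D\nabla Y\cdot\nabla V=\int_{Q_T}S(t,x,Y)\cdot V .$$ Let $U_0\in L^\infty(\Omega)^n$, $H^J=(h_1,\dots,h_m,0,\dots,0)$, and consider, with Neumann boundary conditions and $U(0,\cdot)=U_0$, the system $$\text{(NL-U)}\qquad \partial_tu_i-d_i\Delta u_i=f_i(U)+h_i1_\omega1_{i\le m}\quad\text{in }Q_T,\ 1\le i\le n.$$ Let $Z=P(U-U^*)$ and $Z_0=P(U_0-U^*)$, and consider, with Neumann boundary conditions and $Z(0,\cdot)=Z_0$, the cascade system $$\text{(NL-Z)}\qquad\begin{cases}\partial_tz_i-d_i\Delta z_i=f_i(P^{-1}Z+U^*)+h_i1_\omega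 & 1\le i\le m,\\[2pt] \partial_tz_{m+1}-d_{m+1}\Delta z_{m+1}=\dfrac{f_{m+1}(P^{-1}Z+U^*)}{\beta_{m+1}-\alpha_{m+1}},\\[4pt] \partial_tz_i-d_i\Delta z_i=\Delta z_{i-1} & m+2\le i\le n.\end{cases}$$ For either system, the pair (state, $H^J$) is called a solution if $h_1,\dots,h_m\in L^\infty(Q_T)$ and the state is a weak solution in the above sense, and a trajectory if moreover the state is the unique weak solution with its initial datum and the given controls. Then $P$ is invertible, and for all $U_0$, $U$ and $H^J$ as above: $(U,H^J)$ is a trajectory of (NL-U) if and only if $(Z,H^J)$ is a trajectory of (NL-Z); and likewise $(U,H^J)$ is a solution of (NL-U) if and only if $(Z,H^J)$ is a solution of (NL-Z). -/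

import Mathlib

open MeasureTheory Set
open scoped ENNReal

noncomputable section

namespace ReactionDiffusion

/-- Euclidean space `ℝᴺ`. -/
abbrev E (N : ℕ) : Type := EuclideanSpace ℝ (Fin N)

/-- `L²(Ω)`. -/
abbrev L2 {N : ℕ} (Ω : Set (E N)) : Type := Lp ℝ 2 (volume.restrict Ω)

/-- `L²(Ω; ℝᴺ)`. -/
abbrev L2Vec {N : ℕ} (Ω : Set (E N)) : Type := Lp (E N) 2 (volume.restrict Ω)

/-- Test functions on an open set: smooth with compact support contained in the set. -/
structure IsTestFun {F : Type} [NormedAddCommGroup F] [NormedSpace ℝ F]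
    (O : Set F) (φ : F → ℝ) : Prop where
  smooth : ContDiff ℝ ((⊤ : ℕ∞) : WithTop ℕ∞) φ
  compact : HasCompactSupport φ
  supp : tsupport φ ⊆ O

/-- `g` is the weak gradient of `v` on `Ω`. -/
def HasWeakGradient {N : ℕ} {Ω : Set (E N)} (v : L2 Ω) (g : L2Vec Ω) : Prop :=
  ∀ φ : E N → ℝ, IsTestFun Ω φ → ∀ w : E N,
    ∫ x in Ω, v x * fderiv ℝ φ x w = - ∫ x in Ω, inner ℝ (g x) w * φ x

section Helpers

variable {N : ℕ} {Ω : Set (E N)}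

theorem IsTestFun.memLp {φ : E N → ℝ} (h : IsTestFun Ω φ) :
    MemLp φ 2 (volume.restrict Ω) :=
  (h.smooth.continuous.memLp_of_hasCompactSupport h.compact).restrict Ω

theorem IsTestFun.memLp_fderiv {φ : E N → ℝ} (h : IsTestFun Ω φ) (w : E N) :
    MemLp (fun x => fderiv ℝ φ x w) 2 (volume.restrict Ω) := by
  have hc : Continuous (fun x => fderiv ℝ φ x w) :=
    (h.smooth.continuous_fderiv (by simp)).clm_apply continuous_const
  have hs : HasCompactSupport (fun x => fderiv ℝ φ x w) := h.compact.fderiv_apply ℝ w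
  exact (hc.memLp_of_hasCompactSupport hs).restrict Ω

theorem memLp_inner_const (g : L2Vec Ω) (w : E N) :
    MemLp (fun x => inner ℝ (g x) w) 2 (volume.restrict Ω) :=
  (Lp.memLp g).inner_const w

theorem integrable_left {φ : E N → ℝ} (h : IsTestFun Ω φ) (w : E N) (v : L2 Ω) :
    Integrable (fun x => v x * fderiv ℝ φ x w) (volume.restrict Ω) :=
  (Lp.memLp v).integrable_mul (h.memLp_fderiv w)

theorem integrable_right {φ : E N → ℝ} (h : IsTestFun Ω φ) (w : E N) (g : L2Vec Ω) :
    Integrable (fun x => inner ℝ (g x) w * φ x) (volume.restrict Ω) :=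
  (memLp_inner_const g w).integrable_mul h.memLp

theorem HasWeakGradient.add {v v' : L2 Ω} {g g' : L2Vec Ω}
    (h : HasWeakGradient v g) (h' : HasWeakGradient v' g') :
    HasWeakGradient (v + v') (g + g') := by
  intro φ hφ w
  have e1 : ∫ x in Ω, (v + v' : L2 Ω) x * fderiv ℝ φ x w
      = ∫ x in Ω, (v x * fderiv ℝ φ x w + v' x * fderiv ℝ φ x w) := by
    refine integral_congr_ae ?_
    filter_upwards [Lp.coeFn_add v v'] with x hx
    rw [hx, Pi.add_apply, add_mul]
  have e2 : ∫ x in Ω, inner ℝ ((g + g' : L2Vec Ω) x) w * φ x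
      = ∫ x in Ω, (inner ℝ (g x) w * φ x + inner ℝ (g' x) w * φ x) := by
    refine integral_congr_ae ?_
    filter_upwards [Lp.coeFn_add g g'] with x hx
    rw [hx, Pi.add_apply, inner_add_left, add_mul]
  rw [e1, e2, integral_add (integrable_left hφ w v) (integrable_left hφ w v'),
    integral_add (integrable_right hφ w g) (integrable_right hφ w g'), h φ hφ w, h' φ hφ w]
  ring

theorem HasWeakGradient.smul {v : L2 Ω} {g : L2Vec Ω} (c : ℝ)
    (h : HasWeakGradient v g) : HasWeakGradient (c • v) (c • g) := by
  intro φ hφ w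
  have e1 : ∫ x in Ω, (c • v : L2 Ω) x * fderiv ℝ φ x w
      = ∫ x in Ω, c * (v x * fderiv ℝ φ x w) := by
    refine integral_congr_ae ?_
    filter_upwards [Lp.coeFn_smul c v] with x hx
    rw [hx, Pi.smul_apply, smul_eq_mul, mul_assoc]
  have e2 : ∫ x in Ω, inner ℝ ((c • g : L2Vec Ω) x) w * φ x
      = ∫ x in Ω, c * (inner ℝ (g x) w * φ x) := by
    refine integral_congr_ae ?_
    filter_upwards [Lp.coeFn_smul c g] with x hx
    rw [hx, Pi.smul_apply, real_inner_smul_left, mul_assoc]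
  rw [e1, e2, integral_const_mul, integral_const_mul, h φ hφ w]
  ring

theorem hasWeakGradient_zero : HasWeakGradient (0 : L2 Ω) (0 : L2Vec Ω) := by
  intro φ hφ w
  have e1 : ∫ x in Ω, (0 : L2 Ω) x * fderiv ℝ φ x w = 0 := by
    refine integral_eq_zero_of_ae ?_
    filter_upwards [Lp.coeFn_zero ℝ 2 (volume.restrict Ω)] with x hx
    rw [hx]
    simp
  have e2 : ∫ x in Ω, inner ℝ ((0 : L2Vec Ω) x) w * φ x = 0 := by
    refine integral_eq_zero_of_ae ?_
    filter_upwards [Lp.coeFn_zero (E N) 2 (volume.restrict Ω)] with x hx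
    rw [hx]
    simp
  rw [e1, e2, neg_zero]

end Helpers

/-- The Sobolev space `H¹(Ω)`: pairs `(v, ∇v)` in `L²(Ω) × L²(Ω; ℝᴺ)`, where `∇v` is the weak
gradient of `v`, with the norm `(‖v‖² + ‖∇v‖²)^(1/2)`. -/
def H1 {N : ℕ} (Ω : Set (E N)) : Submodule ℝ (WithLp 2 (L2 Ω × L2Vec Ω)) where
  carrier := {p | HasWeakGradient p.fst p.snd}
  add_mem' := fun ha hb => HasWeakGradient.add ha hb
  zero_mem' := hasWeakGradient_zero
  smul_mem' := fun c _ hp => HasWeakGradient.smul c hp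

/-- The embedding `H¹(Ω) → L²(Ω)`. -/
def H1.val {N : ℕ} {Ω : Set (E N)} : H1 Ω →L[ℝ] L2 Ω :=
  (WithLp.fstL 2 ℝ (L2 Ω) (L2Vec Ω)).comp (H1 Ω).subtypeL

/-- The weak gradient `H¹(Ω) → L²(Ω; ℝᴺ)`. -/
def H1.grad {N : ℕ} {Ω : Set (E N)} : H1 Ω →L[ℝ] L2Vec Ω :=
  (WithLp.sndL 2 ℝ (L2 Ω) (L2Vec Ω)).comp (H1 Ω).subtypeL

theorem memLp_one {N : ℕ} {Ω : Set (E N)} (hb : Bornology.IsBounded Ω) :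
    MemLp (fun _ : E N => (1 : ℝ)) 2 (volume.restrict Ω) := by
  have : IsFiniteMeasure (volume.restrict Ω) := ⟨by
    rw [Measure.restrict_apply_univ]; exact hb.measure_lt_top⟩
  exact memLp_const 1

theorem hasWeakGradient_one {N : ℕ} {Ω : Set (E N)} (hb : Bornology.IsBounded Ω) :
    HasWeakGradient ((memLp_one hb).toLp _) (0 : L2Vec Ω) := by
  intro φ hφ w
  have e2 : ∫ x in Ω, inner ℝ ((0 : L2Vec Ω) x) w * φ x = 0 := by
    refine integral_eq_zero_of_ae ?_
    filter_upwards [Lp.coeFn_zero (E N) 2 (volume.restrict Ω)] with x hx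
    rw [hx]
    simp
  have e1 : ∫ x in Ω, ((memLp_one hb).toLp _ : L2 Ω) x * fderiv ℝ φ x w
      = ∫ x in Ω, fderiv ℝ φ x w := by
    refine integral_congr_ae ?_
    filter_upwards [(memLp_one hb).coeFn_toLp] with x hx
    rw [hx, one_mul]
  have hc : Continuous (fun x => fderiv ℝ φ x w) :=
    (hφ.smooth.continuous_fderiv (by simp)).clm_apply continuous_const
  have hs : HasCompactSupport (fun x => fderiv ℝ φ x w) := hφ.compact.fderiv_apply ℝ w
  have e3 : ∫ x in Ω, fderiv ℝ φ x w = ∫ x, fderiv ℝ φ x w := by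
    refine setIntegral_eq_integral_of_forall_compl_eq_zero ?_
    intro x hx
    have hx' : x ∉ tsupport φ := fun h => hx (hφ.supp h)
    rw [fderiv_of_notMem_tsupport (𝕜 := ℝ) hx']
    simp
  have e4 := integral_mul_fderiv_eq_neg_fderiv_mul_of_integrable (μ := (volume : Measure (E N)))
    (f := fun _ => (1 : ℝ)) (g := φ) (v := w) (by simp)
    (by simpa using hc.integrable_of_hasCompactSupport hs)
    (by simpa using hφ.smooth.continuous.integrable_of_hasCompactSupport hφ.compact)
    (fun x _ => differentiableAt_const _)
    (fun x _ => hφ.smooth.differentiable (by simp) x)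
  simp only [one_mul, fderiv_fun_const, Pi.zero_apply, _root_.zero_apply,
    zero_mul, integral_zero, neg_zero] at e4
  rw [e1, e2, e3, e4, neg_zero]

/-- The constant function `1` as an element of `H¹(Ω)`, for bounded `Ω`. -/
def oneH1 {N : ℕ} {Ω : Set (E N)} (hb : Bornology.IsBounded Ω) : H1 Ω :=
  ⟨WithLp.toLp 2 ((memLp_one hb).toLp _, 0), hasWeakGradient_one hb⟩

/-- The embedding `H¹(Ω) → (H¹(Ω))'` given by the `L²(Ω)` inner product. -/
def H1.toDual {N : ℕ} {Ω : Set (E N)} (v : H1 Ω) : H1 Ω →L[ℝ] ℝ :=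
  (innerSL ℝ (H1.val v)).comp H1.val

/-- `du` is the weak time derivative on `(0,T)` of `u`, with values in `(H¹(Ω))'`. -/
def HasWeakTimeDeriv {N : ℕ} {Ω : Set (E N)} (T : ℝ) (u : ℝ → H1 Ω)
    (du : ℝ → (H1 Ω →L[ℝ] ℝ)) : Prop :=
  ∀ φ : ℝ → ℝ, IsTestFun (Ioo 0 T) φ →
    ∫ t in Ioo 0 T, deriv φ t • H1.toDual (u t) = - ∫ t in Ioo 0 T, φ t • du t

/-- `u ∈ W_T = L²(0,T; H¹(Ω)) ∩ H¹(0,T; (H¹(Ω))')`, with time derivative `du`. -/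
structure MemW {N : ℕ} {Ω : Set (E N)} (T : ℝ) (u : ℝ → H1 Ω)
    (du : ℝ → (H1 Ω →L[ℝ] ℝ)) : Prop where
  memLp : MemLp u 2 (volume.restrict (Ioo 0 T))
  memLp_deriv : MemLp du 2 (volume.restrict (Ioo 0 T))
  hasWeakTimeDeriv : HasWeakTimeDeriv T u du

/-- `u(0,·) = u₀`, for the representative of `u` in `C([0,T]; L²(Ω))`. -/
def HasInitialValue {N : ℕ} {Ω : Set (E N)} (T : ℝ) (u : ℝ → H1 Ω) (u₀ : E N → ℝ) : Prop :=
  ∃ ũ : ℝ → L2 Ω, ContinuousOn ũ (Icc 0 T) ∧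
    (∀ᵐ t ∂(volume.restrict (Ioo 0 T)), ũ t = H1.val (u t)) ∧
    ũ 0 =ᵐ[volume.restrict Ω] u₀

/-- `u ∈ L^∞((0,T) × Ω)`. -/
def EssBounded {N : ℕ} {Ω : Set (E N)} (T : ℝ) (u : ℝ → H1 Ω) : Prop :=
  ∃ M : ℝ, ∀ᵐ t ∂(volume.restrict (Ioo 0 T)), ∀ᵐ x ∂(volume.restrict Ω), |H1.val (u t) x| ≤ M

/-- `U ∈ (W_T ∩ L^∞(Q_T))ⁿ` is a weak solution of
`∂ₜU - D ΔU = S(t, x, U(t, x))` in `Q_T = (0,T) × Ω`, `∂U/∂ν = 0` on `(0,T) × ∂Ω`,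
`U(0,·) = U₀` in `Ω`: for every `V ∈ L²(0,T; H¹(Ω)ⁿ)`,
`∫₀ᵀ ⟨∂ₜU, V⟩ + ∫_{Q_T} D∇U · ∇V = ∫_{Q_T} S(t, x, U) · V`. -/
def IsWeakSolution {N n : ℕ} {Ω : Set (E N)} (T : ℝ) (D : Matrix (Fin n) (Fin n) ℝ)
    (S : ℝ → E N → (Fin n → ℝ) → (Fin n → ℝ)) (U₀ : Fin n → E N → ℝ)
    (U : Fin n → ℝ → H1 Ω) : Prop :=
  (∀ i, EssBounded T (U i)) ∧ (∀ i, HasInitialValue T (U i) (U₀ i)) ∧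
  ∃ dU : Fin n → ℝ → (H1 Ω →L[ℝ] ℝ), (∀ i, MemW T (U i) (dU i)) ∧
    ∀ V : Fin n → ℝ → H1 Ω, (∀ i, MemLp (V i) 2 (volume.restrict (Ioo 0 T))) →
      (∫ t in Ioo 0 T, ∑ i, dU i t (V i t)) +
        (∫ t in Ioo 0 T, ∑ i, ∑ j, D i j *
          ∫ x in Ω, inner ℝ (H1.grad (U j t) x) (H1.grad (V i t) x)) =
      ∫ t in Ioo 0 T, ∫ x in Ω,
        ∑ i, S t x (fun k => H1.val (U k t) x) i * H1.val (V i t) x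

/-- `U` is a weak solution as above and, up to equality a.e. in time, the only one. -/
def IsTheWeakSolution {N n : ℕ} {Ω : Set (E N)} (T : ℝ) (D : Matrix (Fin n) (Fin n) ℝ)
    (S : ℝ → E N → (Fin n → ℝ) → (Fin n → ℝ)) (U₀ : Fin n → E N → ℝ)
    (U : Fin n → ℝ → H1 Ω) : Prop :=
  IsWeakSolution T D S U₀ U ∧
  ∀ U' : Fin n → ℝ → H1 Ω, IsWeakSolution T D S U₀ U' →
    ∀ i, ∀ᵐ t ∂(volume.restrict (Ioo 0 T)), U' i t = U i t

/-- `fᵢ(a) = (βᵢ - αᵢ) (∏ aₖ^αₖ - ∏ aₖ^βₖ)`. -/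
def reaction {n : ℕ} (α β : Fin n → ℕ) (a : Fin n → ℝ) (i : Fin n) : ℝ :=
  ((β i : ℝ) - (α i : ℝ)) * (∏ k, a k ^ α k - ∏ k, a k ^ β k)

/-- The control term `H^J 1_ω = (h₁ 1_ω, …, h_m 1_ω, 0, …, 0)`. -/
def controlTerm {N n m : ℕ} (ω : Set (E N)) (H : Fin m → ℝ → E N → ℝ)
    (t : ℝ) (x : E N) (i : Fin n) : ℝ :=
  if hi : i.1 < m then ω.indicator (H ⟨i.1, hi⟩ t) x else 0

/-- The controls belong to `L^∞((0,T) × Ω)^m`. -/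
def ControlsBounded {N m : ℕ} (Ω : Set (E N)) (T : ℝ) (H : Fin m → ℝ → E N → ℝ) : Prop :=
  ∀ j, MemLp (fun p : ℝ × E N => H j p.1 p.2) ∞ (volume.restrict (Ioo 0 T ×ˢ Ω))

/-- Right-hand side `F(U) + H^J 1_ω` of the controlled reaction-diffusion system. -/
def sourceU {N n m : ℕ} (α β : Fin n → ℕ) (ω : Set (E N)) (H : Fin m → ℝ → E N → ℝ)
    (t : ℝ) (x : E N) (a : Fin n → ℝ) (i : Fin n) : ℝ :=
  reaction α β a i + controlTerm ω H t x i

/-- `(U, H^J)` satisfies the controlled reaction-diffusion system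
`∂ₜuᵢ - dᵢ Δuᵢ = fᵢ(U) + hᵢ 1_ω 1_{i ≤ m}`, with Neumann conditions and initial datum `U₀`. -/
def SolvesNLU {N n m : ℕ} {Ω : Set (E N)} (T : ℝ) (ω : Set (E N)) (d : Fin n → ℝ)
    (α β : Fin n → ℕ) (U₀ : Fin n → E N → ℝ) (U : Fin n → ℝ → H1 Ω)
    (H : Fin m → ℝ → E N → ℝ) : Prop :=
  ControlsBounded Ω T H ∧ IsWeakSolution T (Matrix.diagonal d) (sourceU α β ω H) U₀ U

/-- `(U, H^J)` is a trajectory: `U` is the unique solution associated with `U₀` and `H^J`. -/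
def IsTrajectoryNLU {N n m : ℕ} {Ω : Set (E N)} (T : ℝ) (ω : Set (E N)) (d : Fin n → ℝ)
    (α β : Fin n → ℕ) (U₀ : Fin n → E N → ℝ) (U : Fin n → ℝ → H1 Ω)
    (H : Fin m → ℝ → E N → ℝ) : Prop :=
  ControlsBounded Ω T H ∧ IsTheWeakSolution T (Matrix.diagonal d) (sourceU α β ω H) U₀ U

/-- The matrix `P` of the change of variables. Indices start at `0`, so that the block of the
components `m+1, …, n` consists of the indices `≥ m`. -/
def matrixP {n : ℕ} (m : ℕ) (d : Fin n → ℝ) (α β : Fin n → ℕ) : Matrix (Fin n) (Fin n) ℝ :=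
  fun k l =>
    if k.1 < m ∨ l.1 < m then (if k = l then 1 else 0)
    else if l ≤ k then
      (((β l : ℝ) - (α l : ℝ)) *
        ∏ r ∈ Finset.univ.filter (fun r : Fin n => m ≤ r.1 ∧ r ≤ k ∧ r ≠ l), (d l - d r))⁻¹
    else 0

/-- Diffusion matrix of the cascade system: `dᵢ` on the diagonal, and in the rows of the components
`m+2, …, n` an additional `1` just to the left of the diagonal (the coupling term `Δz_{i-1}`). -/
def cascadeD {n : ℕ} (m : ℕ) (d : Fin n → ℝ) : Matrix (Fin n) (Fin n) ℝ :=
  fun i j => if i = j then d i else if m < i.1 ∧ j.1 + 1 = i.1 then 1 else 0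

/-- Right-hand side of the cascade system: `fᵢ(P⁻¹Z + U*) + hᵢ 1_ω` for the components
`i = 1, …, m`, `f_{m+1}(P⁻¹Z + U*) / (β_{m+1} - α_{m+1})` for the component `m+1`, and `0` for the
components `m+2, …, n`. -/
def sourceZ {N n m : ℕ} (d : Fin n → ℝ) (α β : Fin n → ℕ) (uStar : Fin n → ℝ) (ω : Set (E N))
    (H : Fin m → ℝ → E N → ℝ) (t : ℝ) (x : E N) (a : Fin n → ℝ) (i : Fin n) : ℝ :=
  if i.1 < m then
    reaction α β ((matrixP m d α β)⁻¹.mulVec a + uStar) i + controlTerm ω H t x i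
  else if i.1 = m then
    reaction α β ((matrixP m d α β)⁻¹.mulVec a + uStar) i / ((β i : ℝ) - (α i : ℝ))
  else 0

/-- `(Z, H^J)` satisfies the cascade system
`∂ₜzᵢ - dᵢ Δzᵢ = fᵢ(P⁻¹Z + U*) + hᵢ 1_ω` for `1 ≤ i ≤ m`,
`∂ₜz_{m+1} - d_{m+1} Δz_{m+1} = f_{m+1}(P⁻¹Z + U*) / (β_{m+1} - α_{m+1})`,
`∂ₜzᵢ - dᵢ Δzᵢ = Δz_{i-1}` for `m+2 ≤ i ≤ n`,
with Neumann conditions and initial datum `Z₀`. -/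
def SolvesNLZ {N n m : ℕ} {Ω : Set (E N)} (T : ℝ) (ω : Set (E N)) (d : Fin n → ℝ)
    (α β : Fin n → ℕ) (uStar : Fin n → ℝ) (Z₀ : Fin n → E N → ℝ) (Z : Fin n → ℝ → H1 Ω)
    (H : Fin m → ℝ → E N → ℝ) : Prop :=
  ControlsBounded Ω T H ∧ IsWeakSolution T (cascadeD m d) (sourceZ d α β uStar ω H) Z₀ Z

/-- `(Z, H^J)` satisfies the cascade system, and `Z` is the unique solution associated with `Z₀`
and `H^J`. -/
def IsTrajectoryNLZ {N n m : ℕ} {Ω : Set (E N)} (T : ℝ) (ω : Set (E N)) (d : Fin n → ℝ)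
    (α β : Fin n → ℕ) (uStar : Fin n → ℝ) (Z₀ : Fin n → E N → ℝ) (Z : Fin n → ℝ → H1 Ω)
    (H : Fin m → ℝ → E N → ℝ) : Prop :=
  ControlsBounded Ω T H ∧ IsTheWeakSolution T (cascadeD m d) (sourceZ d α β uStar ω H) Z₀ Z

/-- `Z = P (U - U*)`. -/
def changeVar {N n : ℕ} {Ω : Set (E N)} (hb : Bornology.IsBounded Ω)
    (P : Matrix (Fin n) (Fin n) ℝ) (uStar : Fin n → ℝ) (U : Fin n → ℝ → H1 Ω) :
    Fin n → ℝ → H1 Ω :=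
  fun i t => ∑ l, P i l • (U l t - uStar l • oneH1 hb)

/-- `Z₀ = P (U₀ - U*)`. -/
def changeVarInit {N n : ℕ} (P : Matrix (Fin n) (Fin n) ℝ) (uStar : Fin n → ℝ)
    (U₀ : Fin n → E N → ℝ) : Fin n → E N → ℝ :=
  fun i x => ∑ l, P i l * (U₀ l x - uStar l)

end ReactionDiffusion

end

/-! The map `Y ↦ A Y + c` with `A` invertible sends weak solutions for `(D, S)` to weak solutions
for `(D', S')` as soon as `A D = D' A` and `A S(a) = S'(A a + c)`: test the equation for `Y` with
the transpose of `A` applied to `V` (`IsWeakSolution.affineVar`). The constant `c` contributes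
neither a gradient nor a time derivative. The inverse map has the same form, which gives the
equivalence for solutions. Uniqueness is transported too, since competitors correspond to
competitors.

With `A = P`, `c = -P U*`, two algebraic facts remain. Indices start at `0`, so the second block is
formed by the indices `≥ m`. Diffusion (`matrixP_mul_diagonal`): passing from row `k - 1` to row `k`
divides the entry in column `l` by `d l - d k`. Hence `P k l * d l = d k * P k l + P (k-1) l`, which
is the cascade. Reaction (`matrixP_mulVec_sourceU`): all `f_l` are multiples, by `β l - α l`, of one
function. That function is therefore multiplied in row `k ≥ m` by `∑ 1 / ∏ (d l - d r)`, the divided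
difference of the constant `1` at the nodes `d m, …, d k`. It equals `1` for a single node and `0`
otherwise, so only the row `k = m` keeps a reaction term. -/

namespace ReactionDiffusion

/-! ### Algebra of the matrix `P`: invertibility and conjugation of the diffusion. -/

section Matrix

variable {n : ℕ}

theorem matrixP_eq_zero_of_lt (m : ℕ) (d : Fin n → ℝ) (α β : Fin n → ℕ) {k l : Fin n}
    (h : k < l) : matrixP m d α β k l = 0 := by
  simp only [matrixP, if_neg h.ne, if_neg h.not_ge, ite_self]

theorem matrixP_diag_ne_zero {m : ℕ} {d : Fin n → ℝ} {α β : Fin n → ℕ}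
    (hdist : ∀ k l : Fin n, m ≤ k.1 → m ≤ l.1 → k ≠ l → d k ≠ d l)
    (hαβ : ∀ i, α i ≠ β i) (k : Fin n) : matrixP m d α β k k ≠ 0 := by
  by_cases hk : k.1 < m
  · simp [matrixP, hk]
  · have h1 : ((β k : ℝ) - α k) ≠ 0 := sub_ne_zero.2 fun h => hαβ k (by exact_mod_cast h.symm)
    simp only [matrixP, hk, or_self, if_false, le_refl, if_true]
    refine inv_ne_zero (mul_ne_zero h1 (Finset.prod_ne_zero_iff.2 fun r hr => ?_))
    simp only [Finset.mem_filter, Finset.mem_univ, true_and] at hr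
    exact sub_ne_zero.2 (hdist k r (not_lt.1 hk) hr.1 hr.2.2.symm)

theorem isUnit_matrixP {m : ℕ} {d : Fin n → ℝ} {α β : Fin n → ℕ}
    (hdist : ∀ k l : Fin n, m ≤ k.1 → m ≤ l.1 → k ≠ l → d k ≠ d l)
    (hαβ : ∀ i, α i ≠ β i) : IsUnit (matrixP m d α β) := by
  rw [Matrix.isUnit_iff_isUnit_det, Matrix.det_of_isLowerTriangular _
    (fun i j hij => matrixP_eq_zero_of_lt m d α β (by simpa using hij)), isUnit_iff_ne_zero]
  exact Finset.prod_ne_zero_iff.2 fun k _ => matrixP_diag_ne_zero hdist hαβ k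

/-- For `m ≤ l < k`, the product defining row `k` has exactly one factor more than that of row `k' =
k - 1`, namely `d l - d k`. In the other columns both sides vanish. -/
theorem matrixP_pred_eq {m : ℕ} {d : Fin n → ℝ} {α β : Fin n → ℕ}
    (hdist : ∀ k l : Fin n, m ≤ k.1 → m ≤ l.1 → k ≠ l → d k ≠ d l)
    {k k' : Fin n} (hk : m < k.1) (hk' : k'.1 + 1 = k.1) (l : Fin n) :
    matrixP m d α β k' l = (d l - d k) * matrixP m d α β k l := by
  have hk1 : ¬ k.1 < m := by omega
  have hk1' : ¬ k'.1 < m := by omega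
  by_cases hl : l.1 < m
  · have h1 : k' ≠ l := fun h => by subst h; omega
    have h2 : k ≠ l := fun h => by subst h; omega
    simp [matrixP, hl, h1, h2]
  by_cases hlk : l ≤ k'
  · have hlk2 : l ≤ k := by rw [Fin.le_def] at *; omega
    have hne : l ≠ k := fun h => by subst h; rw [Fin.le_def] at hlk; omega
    have hprod : Finset.univ.filter (fun r : Fin n => m ≤ r.1 ∧ r ≤ k ∧ r ≠ l)
        = insert k (Finset.univ.filter (fun r : Fin n => m ≤ r.1 ∧ r ≤ k' ∧ r ≠ l)) := by
      ext r
      simp only [Finset.mem_filter, Finset.mem_univ, true_and, Finset.mem_insert, Fin.le_def,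
        Fin.ext_iff, ne_eq] at hne ⊢
      omega
    have hnot : k ∉ Finset.univ.filter (fun r : Fin n => m ≤ r.1 ∧ r ≤ k' ∧ r ≠ l) := by
      simp only [Finset.mem_filter, Finset.mem_univ, true_and, Fin.le_def]
      omega
    have hd : d l - d k ≠ 0 := sub_ne_zero.2 (hdist l k (not_lt.1 hl) hk.le hne)
    simp only [matrixP, hk1, hk1', hl, or_self, if_false, hlk, hlk2, if_true]
    rw [hprod, Finset.prod_insert hnot, mul_left_comm, mul_inv (d l - d k),
      mul_inv_cancel_left₀ hd]
  · rw [matrixP_eq_zero_of_lt m d α β (not_le.1 hlk)]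
    -- Here `l > k - 1`: either `l = k` and the factor `d l - d k` is zero, or `l > k` and the entry
    -- of `P` is zero.
    rcases eq_or_ne l k with rfl | hne
    · simp
    · rw [matrixP_eq_zero_of_lt m d α β, mul_zero]
      simp only [Fin.lt_def, Fin.le_def, ne_eq, Fin.ext_iff] at *
      omega

theorem matrixP_mul_diagonal {m : ℕ} {d : Fin n → ℝ} {α β : Fin n → ℕ}
    (hdist : ∀ k l : Fin n, m ≤ k.1 → m ≤ l.1 → k ≠ l → d k ≠ d l) :
    matrixP m d α β * Matrix.diagonal d = cascadeD m d * matrixP m d α β := by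
  ext k l
  rw [Matrix.mul_diagonal, Matrix.mul_apply]
  by_cases hk : m < k.1
  · have hlt : k.1 - 1 < n := by omega
    set k' : Fin n := ⟨k.1 - 1, hlt⟩ with hk'def
    have hk' : k'.1 + 1 = k.1 := by simp only [hk'def]; omega
    have hne : k ≠ k' := fun h => by rw [Fin.ext_iff] at h; omega
    -- Row `k > m` of `cascadeD` has only two nonzero entries, in columns `k` and `k - 1`.
    rw [Finset.sum_eq_add k k' hne]
    · rw [show cascadeD m d k k = d k by simp [cascadeD],
        show cascadeD m d k k' = 1 by simp [cascadeD, hne, hk, hk'],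
        matrixP_pred_eq hdist hk hk' l]
      ring
    · rintro j - ⟨h1, h2⟩
      have h3 : j.1 + 1 ≠ k.1 := fun h => h2 (Fin.ext (by omega))
      simp [cascadeD, h1.symm, h3]
    · simp
    · simp
  -- For `k ≤ m`, the case `k = m` included, row `k` of `P` is supported on the diagonal: a column
  -- `l < k` satisfies `l < m`.
  · have h0 : matrixP m d α β k l * d l = d k * matrixP m d α β k l := by
      rcases eq_or_ne k l with rfl | hne
      · exact mul_comm _ _
      · have h : matrixP m d α β k l = 0 := by
          rcases lt_or_gt_of_ne hne with hlt | hlt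
          · exact matrixP_eq_zero_of_lt m d α β hlt
          · have hl : l.1 < m := by rw [Fin.lt_def] at hlt; omega
            simp [matrixP, hl, hne]
        rw [h, zero_mul, mul_zero]
    rw [Finset.sum_eq_single k]
    · rw [cascadeD, if_pos rfl, h0]
    · rintro j - h1
      rw [cascadeD, if_neg h1.symm, if_neg fun h => hk h.1, zero_mul]
    · simp

/-! ### Divided differences and the action of `P` on the reaction terms. -/

/-- By Lagrange interpolation of the constant polynomial `1` at the nodes `d l`, the sum is its
coefficient of degree `s.card - 1`. -/
theorem sum_inv_prod_sub {ι : Type*} [DecidableEq ι] (s : Finset ι) (d : ι → ℝ)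
    (hd : Set.InjOn d s) (hs : s.Nonempty) :
    ∑ l ∈ s, (∏ r ∈ s.erase l, (d l - d r))⁻¹ = if s.card = 1 then 1 else 0 := by
  have hpos := hs.card_pos
  have h := Lagrange.coeff_eq_sum (P := (1 : Polynomial ℝ)) hd (by
    rw [Polynomial.degree_one]; exact_mod_cast hpos)
  simp only [Polynomial.eval_one, one_div, Polynomial.coeff_one] at h
  rw [← h]
  -- `s.card - 1 = 0` is equivalent to `s.card = 1` only because `s` is nonempty: the subtraction is
  -- truncated.
  refine if_congr ?_ rfl rfl
  omega

/-- The factor `β l - α l` cancels the one in the denominator of `P k l`, leaving the divided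
difference over the nodes with index in `[m, k]`. -/
theorem sum_matrixP_mul {m : ℕ} {d : Fin n → ℝ} {α β : Fin n → ℕ}
    (hdist : ∀ k l : Fin n, m ≤ k.1 → m ≤ l.1 → k ≠ l → d k ≠ d l)
    (hαβ : ∀ i, α i ≠ β i) {k : Fin n} (hk : m ≤ k.1) :
    ∑ l, matrixP m d α β k l * ((β l : ℝ) - α l) = if k.1 = m then 1 else 0 := by
  set s : Finset (Fin n) := Finset.univ.filter (fun r => m ≤ r.1 ∧ r ≤ k) with hs
  have hks : k ∈ s := by simp [hs, hk]
  have hinj : Set.InjOn d s := by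
    intro a ha b hb hab
    simp only [hs, Finset.coe_filter, Finset.mem_univ, true_and, Set.mem_ofPred_eq] at ha hb
    by_contra hne
    exact hdist a b ha.1 hb.1 hne hab
  have hcard : s.card = 1 ↔ k.1 = m := by
    rw [Finset.card_eq_one]
    constructor
    · rintro ⟨a, ha⟩
      have h1 : (⟨m, hk.trans_lt k.2⟩ : Fin n) ∈ s :=
        Finset.mem_filter.2 ⟨Finset.mem_univ _, le_rfl, hk⟩
      rw [ha, Finset.mem_singleton] at h1 hks
      rw [hks, ← h1]
    · intro h
      refine ⟨k, ?_⟩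
      ext r
      simp only [hs, Finset.mem_filter, Finset.mem_univ, true_and, Finset.mem_singleton,
        Fin.le_def, Fin.ext_iff]
      omega
  have hsum := sum_inv_prod_sub s d hinj ⟨k, hks⟩
  rw [if_congr hcard rfl rfl] at hsum
  rw [← hsum, ← Finset.sum_subset (Finset.subset_univ s)]
  · refine Finset.sum_congr rfl fun l hl => ?_
    have hl' := hl
    simp only [hs, Finset.mem_filter, Finset.mem_univ, true_and] at hl'
    have h1 : ((β l : ℝ) - α l) ≠ 0 := sub_ne_zero.2 fun h => hαβ l (by exact_mod_cast h.symm)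
    have he : s.erase l = Finset.univ.filter (fun r : Fin n => m ≤ r.1 ∧ r ≤ k ∧ r ≠ l) := by
      ext r
      simp only [hs, Finset.mem_erase, Finset.mem_filter, Finset.mem_univ, true_and]
      tauto
    simp only [matrixP, not_lt.2 hk, not_lt.2 hl'.1, or_self, if_false, hl'.2, if_true]
    rw [he, mul_inv, mul_right_comm, inv_mul_cancel₀ h1, one_mul]
  · intro l _ hl
    simp only [hs, Finset.mem_filter, Finset.mem_univ, true_and, not_and] at hl
    by_cases h : m ≤ l.1
    · rw [matrixP_eq_zero_of_lt m d α β (not_le.1 (hl h)), zero_mul]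
    · have hne : k ≠ l := fun h' => h (h' ▸ hk)
      simp [matrixP, not_le.1 h, hne]

/-- The controls act on the components `< m`, where `P` is the identity; the rows `≥ m` of `P` do
not see those components. -/
theorem matrixP_mulVec_sourceU {N m : ℕ} {d : Fin n → ℝ} {α β : Fin n → ℕ}
    (hdist : ∀ k l : Fin n, m ≤ k.1 → m ≤ l.1 → k ≠ l → d k ≠ d l)
    (hαβ : ∀ i, α i ≠ β i) (uStar : Fin n → ℝ) (ω : Set (E N)) (H : Fin m → ℝ → E N → ℝ)
    (t : ℝ) (x : E N) (b : Fin n → ℝ) :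
    (matrixP m d α β).mulVec (sourceU α β ω H t x ((matrixP m d α β)⁻¹.mulVec b + uStar))
      = sourceZ d α β uStar ω H t x b := by
  ext k
  set a := (matrixP m d α β)⁻¹.mulVec b + uStar with ha
  simp only [sourceZ, ← ha, Matrix.mulVec, dotProduct]
  by_cases hk : k.1 < m
  · rw [if_pos hk, Finset.sum_eq_single k]
    · simp [matrixP, hk, sourceU]
    · intro l _ hl
      simp [matrixP, hk, hl.symm]
    · simp
  · have hterm : ∀ l, matrixP m d α β k l * sourceU α β ω H t x a l
        = matrixP m d α β k l * ((β l : ℝ) - α l) * (∏ j, a j ^ α j - ∏ j, a j ^ β j) := by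
      intro l
      by_cases hl : l.1 < m
      · have hne : k ≠ l := fun h => hk (h ▸ hl)
        simp [matrixP, hl, hne]
      · simp only [sourceU, reaction, controlTerm, hl, dif_neg, not_false_eq_true, add_zero]
        ring
    have h1 : ((β k : ℝ) - α k) ≠ 0 := sub_ne_zero.2 fun h => hαβ k (by exact_mod_cast h.symm)
    rw [if_neg hk, Finset.sum_congr rfl fun l _ => hterm l, ← Finset.sum_mul,
      sum_matrixP_mul hdist hαβ (not_lt.1 hk)]
    by_cases hkm : k.1 = m
    · rw [if_pos hkm, if_pos hkm, reaction, mul_div_cancel_left₀ _ h1, one_mul]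
    · rw [if_neg hkm, if_neg hkm, zero_mul]

end Matrix

/-! ### Affine changes of unknowns: bounds and initial values. -/

section Affine

variable {N n : ℕ} {Ω : Set (E N)}

/-- The change of unknowns `Y ↦ A Y + c`. -/
noncomputable def affineVar (hb : Bornology.IsBounded Ω) (A : Matrix (Fin n) (Fin n) ℝ) (c : Fin n → ℝ)
    (Y : Fin n → ℝ → H1 Ω) : Fin n → ℝ → H1 Ω :=
  fun i t => (∑ l, A i l • Y l t) + c i • oneH1 hb

/-- The change of initial data `Y₀ ↦ A Y₀ + c`. -/
def affineInit (A : Matrix (Fin n) (Fin n) ℝ) (c : Fin n → ℝ) (Y₀ : Fin n → E N → ℝ) :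
    Fin n → E N → ℝ :=
  fun i x => (∑ l, A i l * Y₀ l x) + c i

theorem H1.val_oneH1 (hb : Bornology.IsBounded Ω) :
    H1.val (oneH1 hb) = (memLp_one hb).toLp _ := rfl

theorem H1.grad_oneH1 (hb : Bornology.IsBounded Ω) : H1.grad (oneH1 hb) = 0 := rfl

theorem coeFn_sum_smul {ι : Type*} (s : Finset ι) (c : ι → ℝ) (f : ι → L2 Ω) :
    ∀ᵐ x ∂(volume.restrict Ω), (∑ l ∈ s, c l • f l : L2 Ω) x = ∑ l ∈ s, c l * f l x := by
  classical
  induction s using Finset.induction_on with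
  | empty =>
    filter_upwards [Lp.coeFn_zero ℝ 2 (volume.restrict Ω)] with x hx
    rw [Finset.sum_empty, Finset.sum_empty, hx, Pi.zero_apply]
  | insert a s ha ih =>
    rw [Finset.sum_insert ha]
    filter_upwards [ih, Lp.coeFn_add (c a • f a) (∑ l ∈ s, c l • f l), Lp.coeFn_smul (c a) (f a)]
      with x h1 h2 h3
    rw [Finset.sum_insert ha, h2, Pi.add_apply, h3, Pi.smul_apply, smul_eq_mul, h1]

theorem coeFn_sum_smul_add_one (hb : Bornology.IsBounded Ω) (a : Fin n → ℝ) (c : ℝ)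
    (f : Fin n → L2 Ω) :
    ∀ᵐ x ∂(volume.restrict Ω),
      (((∑ l, a l • f l) + c • (memLp_one hb).toLp _ : L2 Ω)) x = (∑ l, a l * f l x) + c := by
  filter_upwards [coeFn_sum_smul Finset.univ a f,
    Lp.coeFn_add (∑ l, a l • f l) (c • (memLp_one hb).toLp _),
    Lp.coeFn_smul c ((memLp_one hb).toLp _), (memLp_one hb).coeFn_toLp] with x h1 h2 h3 h4
  rw [h2, Pi.add_apply, h1, h3, Pi.smul_apply, h4, smul_eq_mul, mul_one]

theorem H1.val_affineVar (hb : Bornology.IsBounded Ω) (A : Matrix (Fin n) (Fin n) ℝ)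
    (c : Fin n → ℝ) (Y : Fin n → ℝ → H1 Ω) (i : Fin n) (t : ℝ) :
    H1.val (affineVar hb A c Y i t)
      = (∑ l, A i l • H1.val (Y l t)) + c i • (memLp_one hb).toLp _ := by
  simp only [affineVar, map_add, map_sum, map_smul, H1.val_oneH1]

theorem H1.grad_affineVar (hb : Bornology.IsBounded Ω) (A : Matrix (Fin n) (Fin n) ℝ)
    (c : Fin n → ℝ) (Y : Fin n → ℝ → H1 Ω) (i : Fin n) (t : ℝ) :
    H1.grad (affineVar hb A c Y i t) = ∑ l, A i l • H1.grad (Y l t) := by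
  simp only [affineVar, map_add, map_sum, map_smul, H1.grad_oneH1, smul_zero, add_zero]

theorem H1.coeFn_val_affineVar (hb : Bornology.IsBounded Ω) (A : Matrix (Fin n) (Fin n) ℝ)
    (c : Fin n → ℝ) (Y : Fin n → ℝ → H1 Ω) (i : Fin n) (t : ℝ) :
    ∀ᵐ x ∂(volume.restrict Ω),
      H1.val (affineVar hb A c Y i t) x = (∑ l, A i l * H1.val (Y l t) x) + c i := by
  rw [H1.val_affineVar]
  exact coeFn_sum_smul_add_one hb (A i) (c i) fun l => H1.val (Y l t)

theorem EssBounded.affineVar {T : ℝ} (hb : Bornology.IsBounded Ω)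
    (A : Matrix (Fin n) (Fin n) ℝ) (c : Fin n → ℝ) {Y : Fin n → ℝ → H1 Ω}
    (hY : ∀ i, EssBounded T (Y i)) (i : Fin n) : EssBounded T (affineVar hb A c Y i) := by
  choose M hM using hY
  refine ⟨(∑ l, |A i l| * M l) + |c i|, ?_⟩
  filter_upwards [ae_all_iff.2 hM] with t ht
  filter_upwards [H1.coeFn_val_affineVar hb A c Y i t, ae_all_iff.2 ht] with x hx hxt
  rw [hx]
  refine (abs_add_le _ _).trans (add_le_add_left ((Finset.abs_sum_le_sum_abs _ _).trans
    (Finset.sum_le_sum fun l _ => ?_)) _)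
  rw [abs_mul]
  exact mul_le_mul_of_nonneg_left (hxt l) (abs_nonneg _)

theorem HasInitialValue.affineVar {T : ℝ} (hb : Bornology.IsBounded Ω)
    (A : Matrix (Fin n) (Fin n) ℝ) (c : Fin n → ℝ) {Y : Fin n → ℝ → H1 Ω}
    {Y₀ : Fin n → E N → ℝ} (hY : ∀ i, HasInitialValue T (Y i) (Y₀ i)) (i : Fin n) :
    HasInitialValue T (affineVar hb A c Y i) (affineInit A c Y₀ i) := by
  choose v hv1 hv2 hv3 using hY
  refine ⟨fun t => (∑ l, A i l • v l t) + c i • (memLp_one hb).toLp _, ?_, ?_, ?_⟩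
  · exact (continuousOn_finsetSum _ fun l _ => (hv1 l).const_smul (A i l)).add continuousOn_const
  · filter_upwards [ae_all_iff.2 hv2] with t ht
    simp only [H1.val_affineVar, ht]
  · filter_upwards [coeFn_sum_smul_add_one hb (A i) (c i) fun l => v l 0, ae_all_iff.2 hv3]
      with x h1 h2
    simp only [h1, h2, affineInit]

/-! ### Affine changes of unknowns: weak time derivatives and the space `W_T`. -/

/-- The embedding of `H¹(Ω)` into its dual, as a bounded linear map. -/
noncomputable def H1.toDualL : H1 Ω →L[ℝ] (H1 Ω →L[ℝ] ℝ) :=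
  (isBoundedBilinearMap_inner (𝕜 := ℝ) (E := L2 Ω)).toContinuousLinearMap.bilinearComp
    H1.val H1.val

theorem H1.toDualL_apply (v : H1 Ω) : H1.toDualL v = H1.toDual v := by
  ext w
  rfl

/-- This makes the constant translation disappear from weak time derivatives. -/
theorem IsTestFun.integral_deriv_eq_zero {T : ℝ} {φ : ℝ → ℝ} (h : IsTestFun (Ioo 0 T) φ) :
    ∫ t in Ioo 0 T, deriv φ t = 0 := by
  have hc : Continuous (deriv φ) := h.smooth.continuous_deriv (by simp)
  rw [setIntegral_eq_integral_of_forall_compl_eq_zero]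
  · exact integral_eq_zero_of_hasDerivAt_of_integrable
      (fun t => (h.smooth.differentiable (by simp) t).hasDerivAt)
      (hc.integrable_of_hasCompactSupport h.compact.deriv)
      (h.smooth.continuous.integrable_of_hasCompactSupport h.compact)
  · intro t ht
    have ht' : t ∉ tsupport φ := fun h' => ht (h.supp h')
    by_contra hne
    exact ht' (support_deriv_subset (Function.mem_support.2 hne))

theorem integrable_smul_of_hasCompactSupport {F : Type*} [NormedAddCommGroup F] [NormedSpace ℝ F]
    {T : ℝ} {φ : ℝ → ℝ} (hc : Continuous φ) (hs : HasCompactSupport φ) {f : ℝ → F}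
    (hf : MemLp f 2 (volume.restrict (Ioo 0 T))) :
    Integrable (fun t => φ t • f t) (volume.restrict (Ioo 0 T)) := by
  obtain ⟨C, hC⟩ := hc.bounded_above_of_compact_support hs
  exact (hf.integrable (by norm_num)).bdd_smul C hc.aestronglyMeasurable (ae_of_all _ hC)

theorem memLp_sum_smul {F ι : Type*} [Fintype ι] [NormedAddCommGroup F] [NormedSpace ℝ F]
    {T : ℝ} (a : ι → ℝ) {f : ι → ℝ → F} (hf : ∀ l, MemLp (f l) 2 (volume.restrict (Ioo 0 T))) :
    MemLp (fun t => ∑ l, a l • f l t) 2 (volume.restrict (Ioo 0 T)) :=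
  memLp_finsetSum _ fun l _ => (hf l).const_smul (a l)

/-- Weak derivatives in time are compatible with `Y ↦ ∑ₗ aₗ Yₗ + b`. -/
theorem IsTestFun.integral_deriv_smul_affine {F ι : Type*} [Fintype ι] [NormedAddCommGroup F]
    [NormedSpace ℝ F] [CompleteSpace F] {T : ℝ} {φ : ℝ → ℝ} (hφ : IsTestFun (Ioo 0 T) φ)
    (a : ι → ℝ) (b : F) {f g : ι → ℝ → F} (hf : ∀ l, MemLp (f l) 2 (volume.restrict (Ioo 0 T)))
    (hg : ∀ l, MemLp (g l) 2 (volume.restrict (Ioo 0 T)))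
    (h : ∀ l, ∫ t in Ioo 0 T, deriv φ t • f l t = - ∫ t in Ioo 0 T, φ t • g l t) :
    ∫ t in Ioo 0 T, deriv φ t • ((∑ l, a l • f l t) + b)
      = - ∫ t in Ioo 0 T, φ t • ∑ l, a l • g l t := by
  have hc : Continuous (deriv φ) := hφ.smooth.continuous_deriv (by simp)
  have h1 : ∀ l, Integrable (fun t => a l • (deriv φ t • f l t)) (volume.restrict (Ioo 0 T)) :=
    fun l => (integrable_smul_of_hasCompactSupport hc hφ.compact.deriv (hf l)).smul (a l)
  have h2 : ∀ l, Integrable (fun t => a l • (φ t • g l t)) (volume.restrict (Ioo 0 T)) :=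
    fun l => (integrable_smul_of_hasCompactSupport hφ.smooth.continuous hφ.compact (hg l)).smul
      (a l)
  simp only [smul_add, Finset.smul_sum, smul_comm _ (a _)]
  rw [integral_add (integrable_finsetSum _ fun l _ => h1 l)
      (integrable_smul_of_hasCompactSupport hc hφ.compact.deriv (memLp_const b)),
    integral_finsetSum _ (fun l _ => h1 l), integral_finsetSum _ (fun l _ => h2 l),
    integral_smul_const, hφ.integral_deriv_eq_zero, zero_smul, add_zero,
    ← Finset.sum_neg_distrib]
  refine Finset.sum_congr rfl fun l _ => ?_
  rw [integral_smul, integral_smul, h l, smul_neg]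

theorem H1.memLp_toDual {T : ℝ} {u : ℝ → H1 Ω} (hu : MemLp u 2 (volume.restrict (Ioo 0 T))) :
    MemLp (fun t => H1.toDual (u t)) 2 (volume.restrict (Ioo 0 T)) := by
  have h := ContinuousLinearMap.comp_memLp' (𝕜 := ℝ) (𝕜' := ℝ) (σ := RingHom.id ℝ) (E := H1 Ω)
    (F := H1 Ω →L[ℝ] ℝ) H1.toDualL hu
  simpa only [Function.comp_def, H1.toDualL_apply] using h

theorem H1.toDual_affineVar (hb : Bornology.IsBounded Ω) (A : Matrix (Fin n) (Fin n) ℝ)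
    (c : Fin n → ℝ) (Y : Fin n → ℝ → H1 Ω) (i : Fin n) (t : ℝ) :
    H1.toDual (affineVar hb A c Y i t)
      = (∑ l, A i l • H1.toDual (Y l t)) + c i • H1.toDual (oneH1 hb) := by
  simp only [← H1.toDualL_apply, affineVar, map_add, map_sum, map_smul]

theorem memLp_affineVar {T : ℝ} (hb : Bornology.IsBounded Ω)
    (A : Matrix (Fin n) (Fin n) ℝ) (c : Fin n → ℝ) {Y : Fin n → ℝ → H1 Ω}
    (hY : ∀ i, MemLp (Y i) 2 (volume.restrict (Ioo 0 T))) (i : Fin n) :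
    MemLp (affineVar hb A c Y i) 2 (volume.restrict (Ioo 0 T)) := by
  have h1 : MemLp (fun t => ∑ l, A i l • Y l t) 2 (volume.restrict (Ioo 0 T)) :=
    memLp_sum_smul (A i) hY
  have h2 : MemLp (fun _ : ℝ => c i • oneH1 hb) 2 (volume.restrict (Ioo 0 T)) := memLp_const _
  exact h1.add h2

theorem HasWeakTimeDeriv.affineVar {T : ℝ} (hb : Bornology.IsBounded Ω)
    (A : Matrix (Fin n) (Fin n) ℝ) (c : Fin n → ℝ) {Y : Fin n → ℝ → H1 Ω}
    {dY : Fin n → ℝ → (H1 Ω →L[ℝ] ℝ)} (hY : ∀ i, MemW T (Y i) (dY i)) (i : Fin n) :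
    HasWeakTimeDeriv T (affineVar hb A c Y i) (fun t => ∑ l, A i l • dY l t) := by
  intro φ hφ
  have h := IsTestFun.integral_deriv_smul_affine (F := H1 Ω →L[ℝ] ℝ) hφ (A i)
    (c i • H1.toDual (oneH1 hb)) (fun l => H1.memLp_toDual (hY l).memLp)
    (fun l => (hY l).memLp_deriv) fun l => (hY l).hasWeakTimeDeriv φ hφ
  simp only [← H1.toDual_affineVar] at h
  exact h

theorem MemW.affineVar {T : ℝ} (hb : Bornology.IsBounded Ω)
    (A : Matrix (Fin n) (Fin n) ℝ) (c : Fin n → ℝ) {Y : Fin n → ℝ → H1 Ω}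
    {dY : Fin n → ℝ → (H1 Ω →L[ℝ] ℝ)} (hY : ∀ i, MemW T (Y i) (dY i)) (i : Fin n) :
    MemW T (affineVar hb A c Y i) (fun t => ∑ l, A i l • dY l t) where
  memLp := memLp_affineVar hb A c (fun l => (hY l).memLp) i
  memLp_deriv := memLp_sum_smul (F := H1 Ω →L[ℝ] ℝ) (A i) fun l => (hY l).memLp_deriv
  hasWeakTimeDeriv := HasWeakTimeDeriv.affineVar hb A c hY i

/-! ### Transport of the weak formulation. -/

/-- In this form the diffusion term is bilinear in elements of `L²`, so sums and scalars come out
with no integrability condition. -/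
theorem integral_inner_grad (u v : H1 Ω) :
    ∫ x in Ω, inner ℝ (H1.grad u x) (H1.grad v x) = inner ℝ (H1.grad u) (H1.grad v) :=
  (L2.inner_def _ _).symm

/-- Solutions of `∂ₜY - D ΔY = S` are mapped by `Z = A Y + c` to solutions of
`∂ₜZ - D' ΔZ = S'`, as soon as `A D = D' A` and `A S(Y) = S'(A Y + c)`. -/
theorem IsWeakSolution.affineVar {T : ℝ} (hb : Bornology.IsBounded Ω)
    {A D D' : Matrix (Fin n) (Fin n) ℝ} {c : Fin n → ℝ}
    {S S' : ℝ → E N → (Fin n → ℝ) → (Fin n → ℝ)}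
    (hD : A * D = D' * A) (hS : ∀ t x a, A.mulVec (S t x a) = S' t x (A.mulVec a + c))
    {Y₀ : Fin n → E N → ℝ} {Y : Fin n → ℝ → H1 Ω} (hY : IsWeakSolution T D S Y₀ Y) :
    IsWeakSolution T D' S' (affineInit A c Y₀) (affineVar hb A c Y) := by
  obtain ⟨h1, h2, dY, h3, h4⟩ := hY
  refine ⟨EssBounded.affineVar hb A c h1, HasInitialValue.affineVar hb A c h2,
    fun i t => ∑ l, A i l • dY l t, MemW.affineVar hb A c h3, fun V hV => ?_⟩
  -- The test function is the transpose of `A` applied to `V`. Each of the three terms then agrees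
  -- with its counterpart for every fixed `t`, so nothing has to be checked about integrability in
  -- time.
  have key := h4 (fun l t => ∑ i, A i l • V i t)
    (fun l => memLp_sum_smul (fun i => A i l) hV)
  have e1 : ∀ t, ∑ i, (∑ l, A i l • dY l t) (V i t) = ∑ l, dY l t (∑ i, A i l • V i t) := by
    intro t
    simp only [_root_.sum_apply, _root_.smul_apply, map_sum, map_smul]
    exact Finset.sum_comm
  have e2 : ∀ t, ∑ i, ∑ j, D' i j *
        ∫ x in Ω, inner ℝ (H1.grad (ReactionDiffusion.affineVar hb A c Y j t) x)
          (H1.grad (V i t) x)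
      = ∑ l, ∑ j, D l j *
        ∫ x in Ω, inner ℝ (H1.grad (Y j t) x) (H1.grad (∑ i, A i l • V i t) x) := by
    intro t
    simp_rw [integral_inner_grad]
    simp only [H1.grad_affineVar, map_sum, map_smul, sum_inner, inner_sum,
      real_inner_smul_left, real_inner_smul_right]
    -- The only place where `A D = D' A` enters.
    have hD' : ∀ i j, ∑ l, A i l * D l j = ∑ l, D' i l * A l j := fun i j => by
      simpa only [Matrix.mul_apply] using congrFun (congrFun hD i) j
    calc ∑ i, ∑ j, D' i j * ∑ l, A j l * inner ℝ (H1.grad (Y l t)) (H1.grad (V i t))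
        = ∑ i, ∑ l, (∑ j, D' i j * A j l) * inner ℝ (H1.grad (Y l t)) (H1.grad (V i t)) := by
          refine Finset.sum_congr rfl fun i _ => ?_
          simp only [Finset.mul_sum, Finset.sum_mul, mul_assoc]
          exact Finset.sum_comm
      _ = ∑ i, ∑ j, ∑ l, D l j * (A i l * inner ℝ (H1.grad (Y j t)) (H1.grad (V i t))) := by
          simp only [← hD', Finset.sum_mul]
          refine Finset.sum_congr rfl fun i _ => Finset.sum_congr rfl fun j _ =>
            Finset.sum_congr rfl fun l _ => ?_
          ring
      _ = ∑ l, ∑ j, D l j * ∑ i, A i l * inner ℝ (H1.grad (Y j t)) (H1.grad (V i t)) := by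
          simp only [Finset.mul_sum]
          rw [Finset.sum_comm, Finset.sum_comm (s := (Finset.univ : Finset (Fin n)))
            (f := fun l j => ∑ i, D l j * (A i l * inner ℝ (H1.grad (Y j t)) (H1.grad (V i t))))]
          refine Finset.sum_congr rfl fun j _ => Finset.sum_comm
  have e3 : ∀ t, ∫ x in Ω, ∑ i, S' t x
        (fun k => H1.val (ReactionDiffusion.affineVar hb A c Y k t) x) i * H1.val (V i t) x
      = ∫ x in Ω, ∑ l, S t x (fun k => H1.val (Y k t) x) l *
          H1.val (∑ i, A i l • V i t) x := by
    intro t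
    -- The two integrands agree almost everywhere in `x`, so no integrability of the source is
    -- needed.
    refine integral_congr_ae ?_
    have hv : ∀ l, ∀ᵐ x ∂(volume.restrict Ω), H1.val (∑ i, A i l • V i t) x
        = ∑ i, A i l * H1.val (V i t) x := by
      intro l
      simp only [map_sum, map_smul]
      exact coeFn_sum_smul Finset.univ (fun i => A i l) fun i => H1.val (V i t)
    filter_upwards [ae_all_iff.2 hv,
      ae_all_iff.2 fun k => H1.coeFn_val_affineVar hb A c Y k t] with x hx hxY
    have harg : (fun k => H1.val (ReactionDiffusion.affineVar hb A c Y k t) x)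
        = A.mulVec (fun k => H1.val (Y k t) x) + c := by
      ext k
      rw [hxY k]
      rfl
    rw [harg, ← hS]
    simp only [hx, Matrix.mulVec, dotProduct, Finset.sum_mul, Finset.mul_sum]
    rw [Finset.sum_comm]
    refine Finset.sum_congr rfl fun l _ => Finset.sum_congr rfl fun i _ => ?_
    ring
  simp only [e1, e2, e3]
  exact key

/-! ### Inverse change of unknowns, equivalence of the two problems and uniqueness. -/

/-- The inverse of `a ↦ A a + c` is `b ↦ B (b - c)`, whence the translation `-B c`. -/
theorem affineVar_affineVar (hb : Bornology.IsBounded Ω) {A B : Matrix (Fin n) (Fin n) ℝ}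
    (hBA : B * A = 1) (c : Fin n → ℝ) (Y : Fin n → ℝ → H1 Ω) :
    affineVar hb B (-B.mulVec c) (affineVar hb A c Y) = Y := by
  ext1 i
  ext1 t
  have h1 : ∀ l, ∑ j, B i j * A j l = if i = l then 1 else 0 := fun l => by
    simpa only [Matrix.mul_apply, Matrix.one_apply] using congrFun (congrFun hBA i) l
  have h2 : ∑ j, B i j • ∑ l, A j l • Y l t = Y i t := by
    simp only [Finset.smul_sum, smul_smul]
    rw [Finset.sum_comm]
    simp only [← Finset.sum_smul, h1, ite_smul, one_smul, zero_smul, Finset.sum_ite_eq,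
      Finset.mem_univ, if_true]
  simp only [affineVar, smul_add, Finset.sum_add_distrib, h2, smul_smul, ← Finset.sum_smul,
    Pi.neg_apply, Matrix.mulVec, dotProduct, neg_smul, add_neg_cancel_right]

theorem affineInit_affineInit {A B : Matrix (Fin n) (Fin n) ℝ}
    (hBA : B * A = 1) (c : Fin n → ℝ) (Y₀ : Fin n → E N → ℝ) :
    affineInit B (-B.mulVec c) (affineInit A c Y₀) = Y₀ := by
  ext i x
  have h : B.mulVec (A.mulVec (fun k => Y₀ k x) + c) + (-B.mulVec c) = fun k => Y₀ k x := by
    rw [Matrix.mulVec_add, Matrix.mulVec_mulVec, hBA, Matrix.one_mulVec, add_neg_cancel_right]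
  exact congrFun h i

variable {T : ℝ} {A B D D' : Matrix (Fin n) (Fin n) ℝ} {c : Fin n → ℝ}
  {S S' : ℝ → E N → (Fin n → ℝ) → (Fin n → ℝ)} {Y₀ : Fin n → E N → ℝ} {Y : Fin n → ℝ → H1 Ω}

/-- The inverse change of unknowns maps solutions of the new system to solutions of the old one. -/
theorem IsWeakSolution.affineVar_symm (hb : Bornology.IsBounded Ω) (hBA : B * A = 1)
    (hD : A * D = D' * A) (hS : ∀ t x a, A.mulVec (S t x a) = S' t x (A.mulVec a + c))
    {Z : Fin n → ℝ → H1 Ω} (hZ : IsWeakSolution T D' S' (affineInit A c Y₀) Z) :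
    IsWeakSolution T D S Y₀ (ReactionDiffusion.affineVar hb B (-B.mulVec c) Z) := by
  have hAB : A * B = 1 := mul_eq_one_comm.1 hBA
  have hD' : B * D' = D * B := by
    calc B * D' = B * (D' * A) * B := by rw [← mul_assoc, mul_assoc _ A, hAB, mul_one]
      _ = D * B := by rw [← hD, ← mul_assoc, hBA, one_mul]
  have hS' : ∀ t x b, B.mulVec (S' t x b) = S t x (B.mulVec b + -B.mulVec c) := by
    intro t x b
    -- This argument is the preimage of `b` under `a ↦ A a + c`; multiplying the resulting identity
    -- by `B` gives the claim.
    have h := hS t x (B.mulVec b + -B.mulVec c)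
    rw [Matrix.mulVec_add, Matrix.mulVec_neg, Matrix.mulVec_mulVec, Matrix.mulVec_mulVec, hAB,
      Matrix.one_mulVec, Matrix.one_mulVec, neg_add_cancel_right] at h
    rw [← h, Matrix.mulVec_mulVec, hBA, Matrix.one_mulVec]
  have h := hZ.affineVar hb hD' hS'
  rwa [affineInit_affineInit hBA] at h

theorem isWeakSolution_affineVar_iff (hb : Bornology.IsBounded Ω) (hBA : B * A = 1)
    (hD : A * D = D' * A) (hS : ∀ t x a, A.mulVec (S t x a) = S' t x (A.mulVec a + c)) :
    IsWeakSolution T D S Y₀ Y ↔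
      IsWeakSolution T D' S' (affineInit A c Y₀) (affineVar hb A c Y) := by
  refine ⟨fun h => h.affineVar hb hD hS, fun h => ?_⟩
  have h' := h.affineVar_symm hb hBA hD hS
  rwa [affineVar_affineVar hb hBA] at h'

theorem affineVar_congr (hb : Bornology.IsBounded Ω) (A : Matrix (Fin n) (Fin n) ℝ)
    (c : Fin n → ℝ) {Y Z : Fin n → ℝ → H1 Ω}
    (h : ∀ i, ∀ᵐ t ∂(volume.restrict (Ioo 0 T)), Y i t = Z i t) (i : Fin n) :
    ∀ᵐ t ∂(volume.restrict (Ioo 0 T)), affineVar hb A c Y i t = affineVar hb A c Z i t := by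
  filter_upwards [ae_all_iff.2 h] with t ht
  simp only [affineVar, ht]

/-- A competitor for one system is carried to a competitor for the other, identified there by
uniqueness, and carried back; equality a.e. in time survives both maps. -/
theorem isTheWeakSolution_affineVar_iff (hb : Bornology.IsBounded Ω) (hBA : B * A = 1)
    (hD : A * D = D' * A) (hS : ∀ t x a, A.mulVec (S t x a) = S' t x (A.mulVec a + c)) :
    IsTheWeakSolution T D S Y₀ Y ↔
      IsTheWeakSolution T D' S' (affineInit A c Y₀) (affineVar hb A c Y) := by
  refine and_congr (isWeakSolution_affineVar_iff hb hBA hD hS) ⟨fun h Z hZ => ?_, fun h X hX => ?_⟩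
  · have h1 := affineVar_congr hb A c (h _ (hZ.affineVar_symm hb hBA hD hS))
    -- The inverse of the inverse has translation `c`, so `affineVar_affineVar` applies with `A` and
    -- `B` exchanged.
    have hc : c = -A.mulVec (-B.mulVec c) := by
      rw [Matrix.mulVec_neg, neg_neg, Matrix.mulVec_mulVec, mul_eq_one_comm.1 hBA,
        Matrix.one_mulVec]
    have h2 := affineVar_affineVar hb (mul_eq_one_comm.1 hBA) (-B.mulVec c) Z
    rw [← hc] at h2
    rwa [h2] at h1
  · have h1 := affineVar_congr hb B (-B.mulVec c) (h _ (hX.affineVar hb hD hS))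
    rwa [affineVar_affineVar hb hBA, affineVar_affineVar hb hBA] at h1

theorem changeVar_eq_affineVar (hb : Bornology.IsBounded Ω) (P : Matrix (Fin n) (Fin n) ℝ)
    (uStar : Fin n → ℝ) (U : Fin n → ℝ → H1 Ω) :
    changeVar hb P uStar U = affineVar hb P (-P.mulVec uStar) U := by
  ext1 i
  ext1 t
  simp only [changeVar, affineVar, smul_sub, Finset.sum_sub_distrib, smul_smul, ← Finset.sum_smul,
    Pi.neg_apply, Matrix.mulVec, dotProduct, neg_smul]
  rw [sub_eq_add_neg]

theorem changeVarInit_eq_affineInit (P : Matrix (Fin n) (Fin n) ℝ)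
    (uStar : Fin n → ℝ) (U₀ : Fin n → E N → ℝ) :
    changeVarInit P uStar U₀ = affineInit P (-P.mulVec uStar) U₀ := by
  ext i x
  simp only [changeVarInit, affineInit, mul_sub, Finset.sum_sub_distrib, Pi.neg_apply,
    Matrix.mulVec, dotProduct]
  rw [sub_eq_add_neg]

end Affine

end ReactionDiffusion

theorem mainTheorem10 {N n m : ℕ} (hm : m < n)
    (Ω : Set (ReactionDiffusion.E N)) (hΩo : IsOpen Ω) (hΩc : IsConnected Ω)
    (hΩb : Bornology.IsBounded Ω)
    (ω : Set (ReactionDiffusion.E N)) (hωo : IsOpen ω) (hωn : ω.Nonempty) (hωΩ : ω ⊆ Ω)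
    (T : ℝ) (hT : 0 < T)
    (d : Fin n → ℝ) (hd : ∀ i, 0 < d i)
    (hdist : ∀ k l : Fin n, m ≤ k.1 → m ≤ l.1 → k ≠ l → d k ≠ d l)
    (α β : Fin n → ℕ) (hαβ : ∀ i, α i ≠ β i)
    (uStar : Fin n → ℝ) (huStar : ∀ i, 0 ≤ uStar i)
    (hstat : ∏ k, uStar k ^ α k = ∏ k, uStar k ^ β k) :
    IsUnit (ReactionDiffusion.matrixP m d α β) ∧
    ∀ (U₀ : Fin n → ReactionDiffusion.E N → ℝ),
      (∀ i, MemLp (U₀ i) ∞ (volume.restrict Ω)) →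
      ∀ (U : Fin n → ℝ → ReactionDiffusion.H1 Ω) (H : Fin m → ℝ → ReactionDiffusion.E N → ℝ),
        (ReactionDiffusion.IsTrajectoryNLU T ω d α β U₀ U H ↔
          ReactionDiffusion.IsTrajectoryNLZ T ω d α β uStar
            (ReactionDiffusion.changeVarInit (ReactionDiffusion.matrixP m d α β) uStar U₀)
            (ReactionDiffusion.changeVar hΩb (ReactionDiffusion.matrixP m d α β) uStar U) H) ∧
        (ReactionDiffusion.SolvesNLU T ω d α β U₀ U H ↔
          ReactionDiffusion.SolvesNLZ T ω d α β uStar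
            (ReactionDiffusion.changeVarInit (ReactionDiffusion.matrixP m d α β) uStar U₀)
            (ReactionDiffusion.changeVar hΩb (ReactionDiffusion.matrixP m d α β) uStar U) H) := by
  open ReactionDiffusion in
  have hP := isUnit_matrixP (m := m) hdist hαβ
  have hinv : (matrixP m d α β)⁻¹ * matrixP m d α β = 1 :=
    Matrix.nonsing_inv_mul _ ((Matrix.isUnit_iff_isUnit_det _).1 hP)
  refine ⟨hP, fun U₀ _ U H => ?_⟩
  have hS : ∀ t x a, (matrixP m d α β).mulVec (sourceU α β ω H t x a)
      = sourceZ d α β uStar ω H t x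
        ((matrixP m d α β).mulVec a + -(matrixP m d α β).mulVec uStar) := by
    intro t x a
    -- With `b = P a - P U*` one has `P⁻¹ b + U* = a`, so the right-hand side becomes `P` applied to
    -- the source at `a`.
    rw [← matrixP_mulVec_sourceU hdist hαβ, Matrix.mulVec_add, Matrix.mulVec_neg,
      Matrix.mulVec_mulVec, Matrix.mulVec_mulVec, hinv, Matrix.one_mulVec, Matrix.one_mulVec,
      neg_add_cancel_right]
  rw [changeVar_eq_affineVar, changeVarInit_eq_affineInit]
  exact ⟨and_congr Iff.rfl
      (isTheWeakSolution_affineVar_iff hΩb hinv (matrixP_mul_diagonal hdist) hS),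
    and_congr Iff.rfl (isWeakSolution_affineVar_iff hΩb hinv (matrixP_mul_diagonal hdist) hS)⟩
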